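/- **Corollary (control matrices of $W$-codes in $\mathbb F_q[t;\theta]$).** Let $p$ be a prime, $q=p^n$, let $\theta(a)=a^p$ be the Frobenius map of $\mathbb F_q$, and let $R=\mathbb F_q[t;\theta]$ be the ring of skew polynomials $\sum a_it^i$ with $ta=\theta(a)t$ for $a\in\mathbb F_q$. Extend $\theta$ to $R$ by $\theta(\sum a_it^i)=\sum\theta(a_i)t^i$, and put $G(t)=t^{(p-1)n+1}-t$ and $G_0(t)=t^{(p-1)n}-1$. Conventions. A monic $g\in R$ of degree $r$ is a $W$-polynomial if there are $a_1,\dots,a_r\in\mathbb F_q$ with $Rg=\bigcap_{i=1}^rR(t-a_i)$. The value $g(0)$ is the remainder of the division of $g$ by $t$ on the right, i.e. the constant coefficient of $g$. Let $f=t^N+\sum_{j<N}f_jt^j\in R$ be monic of degree $N\ge1$. For $u=\sum_{j<N}u_jt^j$ of degree $<N$ write $\underline u=(u_0,\dots,u_{N-1})$. Let $C_f$ be the companion matrix of $f$ (with $1$'s just above the diagonal, last row $(-f_0,\dots,-f_{N-1})$, and all other entries $0$), and let $T_f(v)=\theta(v)C_f$ for row vectors $v\in\mathbb F_q^N$, where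 $\theta$ acts on vectors componentwise. If $f\in Rg$, the code of $Rg/Rf$ is the set of $c\in\mathbb F_q^N$ such that $\sum_{i<N}c_it^i+Rf\in Rg/Rf$. A matrix $H$ with $N$ rows is a control matrix of a code $C\subseteq\mathbb F_q^N$ if $C=\{c\in\mathbb F_q^N: cH=0\}$. Statement. Let $g\in R$ be a $W$-polynomial of degree $r$ and let $h\in R$ satisfy $G=hg$. (a) There is an integer $l$ with $1\le l\le n$ and $\theta^l(g)=g$; and for every such $l$ one has $G=hg=g\,\theta^{l-1}(h)$. (b) Suppose $r\ge1$. For every $l$ as in (a), the matrix with rows $T_G^i(\theta^{l-1}(\underline h))$, $0\le i\le(p-1)n$, is a control matrix of the code of $Rg/RG$. (c) Suppose $g(0)\ne0$. Then there is $h'\in R$ with $G_0=h'g=gh'$. If moreover $r\ge1$, the matrix with rows $T_{G_0}^i(\underline{h'})$, $0\le i\le(p-1)n-1$, is a control matrix of the code of $Rg/RG_0$. -/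

import Mathlib

noncomputable section

namespace OreCode

/-- The action of the additive monoid of exponents on `A` through the powers of the ring
endomorphism `σ`: the exponent `k` acts as `σ ^ k`. -/
@[reducible] def endoAction {A : Type*} [Ring A] (σ : A →+* A) :
    MulSemiringAction (Multiplicative ℕ) A :=
  MulSemiringAction.compHom A (powersHom (A →+* A) σ)

/-- The Ore extension `A[t; σ]` of endomorphism type (zero derivation): left polynomials
`∑ aᵢ tⁱ` with the commutation law `t a = σ(a) t`. -/
def Ore {A : Type*} [Ring A] (_σ : A →+* A) : Type _ := SkewPolynomial A

instance {A : Type*} [Ring A] (σ : A →+* A) : Ring (Ore σ) :=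
  letI := endoAction σ
  inferInstanceAs (Ring (SkewMonoidAlgebra A (Multiplicative ℕ)))

section Basic

variable {A : Type*} [Ring A] {σ : A →+* A}

/-- The monomial `a tⁿ`. -/
def monomial (n : ℕ) (a : A) : Ore σ := SkewPolynomial.monomial n a

/-- The constant polynomial `a`. -/
def C (a : A) : Ore σ := monomial 0 a

/-- The variable `t`. -/
def X : Ore σ := monomial 1 1

/-- The coefficient (written on the left) of `tⁿ`. -/
def coeff (f : Ore σ) (n : ℕ) : A := SkewPolynomial.coeff f n

theorem monomial_mul_monomial (i j : ℕ) (a b : A) :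
    (monomial i a : Ore σ) * monomial j b = monomial (i + j) (a * σ^[i] b) := by
  let _ := endoAction σ
  have h : (SkewPolynomial.φ : A →+* A) = σ := by
    ext x
    change (powersHom (A →+* A) σ (Multiplicative.ofAdd 1)) x = σ x
    simp
  have := SkewPolynomial.monomial_mul_monomial (R := A) i j a b
  rw [h] at this
  exact this

/-- The commutation law `t a = σ(a) t`. -/
theorem X_mul_C (a : A) : (X : Ore σ) * C a = C (σ a) * X := by
  simp [X, C, monomial_mul_monomial]

/-- `f` is monic of degree `r`. -/
def IsMonicOfDegree (f : Ore σ) (r : ℕ) : Prop :=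
  coeff f r = 1 ∧ ∀ i, r < i → coeff f i = 0

/-- The norms `N₀(a) = 1`, `Nᵢ₊₁(a) = σ(Nᵢ(a)) a`; that is,
`Nᵢ(a) = σⁱ⁻¹(a) ⋯ σ(a) a` is the value of `tⁱ` at `a`. -/
def normPow (σ : A →+* A) (a : A) : ℕ → A
  | 0 => 1
  | i + 1 => σ (normPow σ a i) * a

/-- The right evaluation `f(a) = ∑ bᵢ Nᵢ(a)` of `f = ∑ bᵢ tⁱ`, which is the remainder of the
division of `f` by `t - a` on the right. -/
def eval (f : Ore σ) (a : A) : A := SkewPolynomial.sum f fun i b => b * normPow σ a i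

/-- `g` is a Wedderburn polynomial (`W`-polynomial) of degree `r`: it is monic of degree `r` and
`R g = ⋂ᵢ R (t - aᵢ)` for some `a₁, …, aᵣ ∈ A`. Here `Ideal` means left ideal. -/
def IsWPolynomial (g : Ore σ) (r : ℕ) : Prop :=
  IsMonicOfDegree g r ∧
    ∃ a : Fin r → A, (Ideal.span {g} : Ideal (Ore σ)) = ⨅ i, Ideal.span {X - C (a i)}

/-- The extension of `σ` to `A[t; σ]` fixing `t`: it sends `∑ aᵢ tⁱ` to `∑ σ(aᵢ) tⁱ`. -/
def extend (f : Ore σ) : Ore σ := SkewPolynomial.sum f fun i a => monomial i (σ a)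

/-- The `N`-tuple `(f₀, …, f_{N-1})` of coefficients of a polynomial `f` of degree `< N`. -/
def coeffVec (N : ℕ) (f : Ore σ) : Fin N → A := fun i => coeff f i

/-- The polynomial `∑ vᵢ tⁱ` with coefficients `v₀, …, v_{N-1}`. -/
def vecPoly (σ : A →+* A) {N : ℕ} (v : Fin N → A) : Ore σ := ∑ i : Fin N, monomial (i : ℕ) (v i)

/-- The companion matrix of a monic polynomial `f` of degree `N`: ones above the diagonal, last
row `(-f₀, …, -f_{N-1})`. -/
def companion (N : ℕ) (f : Ore σ) : Matrix (Fin N) (Fin N) A :=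
  Matrix.of fun i j =>
    if (i : ℕ) + 1 = N then -coeff f j else if (j : ℕ) = i + 1 then 1 else 0

/-- The pseudo-linear transformation `T_f(v) = σ(v) C_f` of `A^N` attached to a monic polynomial
`f` of degree `N`. -/
def pseudoLinear (N : ℕ) (f : Ore σ) (v : Fin N → A) : Fin N → A :=
  Matrix.vecMul (fun i => σ (v i)) (companion N f)

/-- The code of `R g / R f`, for `f` monic of degree `N` with `f ∈ R g`: the set of coordinate
vectors of the elements of the cyclic submodule `R g / R f` of `R / R f` in the basis
`1, t, …, t^(N-1)`. -/
def code (N : ℕ) (f g : Ore σ) : Set (Fin N → A) :=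
  {v | (Ideal.span {f} : Submodule (Ore σ) (Ore σ)).mkQ (vecPoly σ v) ∈
    Submodule.map (Ideal.span {f} : Submodule (Ore σ) (Ore σ)).mkQ (Ideal.span {g})}

/-- The `N × N` matrix with rows `v, T_f(v), …, T_f^(N-1)(v)`. -/
def orbitMatrix (N : ℕ) (f : Ore σ) (v : Fin N → A) : Matrix (Fin N) (Fin N) A :=
  Matrix.of fun i => (pseudoLinear N f)^[(i : ℕ)] v

/-- `H` is a control matrix of the left linear code `K`: `K` is the left annihilator of `H`. -/
def IsControlMatrix {N m : ℕ} (H : Matrix (Fin N) (Fin m) A) (K : Set (Fin N → A)) : Prop :=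
  K = {c | Matrix.vecMul c H = 0}

end Basic

section Finite

variable (F : Type*) [Field F] (p n : ℕ) [Fact p.Prime] [CharP F p]

/-- `G = t^((p-1)n+1) - t` in `F[t; θ]`, where `θ` is the Frobenius map `a ↦ a^p`. -/
def polyG : Ore (frobenius F p) := X ^ ((p - 1) * n + 1) - X

/-- `G₀ = t^((p-1)n) - 1` in `F[t; θ]`, where `θ` is the Frobenius map `a ↦ a^p`. -/
def polyG₀ : Ore (frobenius F p) := X ^ ((p - 1) * n) - 1

end Finite

end OreCode

end

open Finset

namespace OreCode

/-! ### Coefficients and the twisted convolution product -/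

section Coefficients

variable {A : Type*} [Ring A] {σ : A →+* A}

/-! Since `θ^n = id`, the power `t^((p-1)n)` is central; hence so is `G₀`, and `G = t G₀` satisfies
`G f = θ(f) G`. This relation moves a right factor `g` of `G` to the left, at the cost of a twist of
the cofactor (`polyG_eq_mul_extend_iterate`). If `g(0) ≠ 0`, a factor `t` cancels from `G = h g`,
and centrality of `G₀` makes the two factors commute (`exists_polyG₀_eq_mul`).

Control matrices come from a two-sided factorization `f = h g = g h'`. As `R` is a domain, `c ∈ R g`
iff `c h' ∈ R g h' = R f`. In coordinates on `R / R f`, multiplication by `t` is `T_f`, so the class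
of `c h' = ∑ cᵢ tⁱ h'` is `∑ cᵢ T_f^i(h')`, which is `c` times the orbit matrix
(`isControlMatrix_orbitMatrix`). The condition `r ≥ 1` gives `deg h' < N`, so `h'` is its own
coordinate vector. -/

theorem ext_coeff {f g : Ore σ} (h : ∀ n, coeff f n = coeff g n) : f = g :=
  SkewMonoidAlgebra.ext fun a => h (Multiplicative.toAdd a)

theorem coeff_zero (n : ℕ) : coeff (0 : Ore σ) n = 0 := rfl

theorem coeff_add (f g : Ore σ) (n : ℕ) : coeff (f + g) n = coeff f n + coeff g n :=
  DFunLike.congr_fun (SkewMonoidAlgebra.coeff_add (k := A) (G := Multiplicative ℕ) f g)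
    (Multiplicative.ofAdd n)

/-- Taking the coefficient of `tⁿ`, as an additive homomorphism. -/
def coeffHom (σ : A →+* A) (n : ℕ) : Ore σ →+ A where
  toFun f := coeff f n
  map_zero' := coeff_zero n
  map_add' f g := coeff_add f g n

theorem coeff_sub (f g : Ore σ) (n : ℕ) : coeff (f - g) n = coeff f n - coeff g n :=
  map_sub (coeffHom σ n) f g

theorem coeff_sum {ι : Type*} (s : Finset ι) (f : ι → Ore σ) (n : ℕ) :
    coeff (∑ i ∈ s, f i) n = ∑ i ∈ s, coeff (f i) n :=
  map_sum (coeffHom σ n) f s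

theorem coeff_monomial (m n : ℕ) (a : A) :
    coeff (monomial m a : Ore σ) n = if m = n then a else 0 :=
  SkewPolynomial.coeff_monomial

theorem monomial_zero (n : ℕ) : (monomial n 0 : Ore σ) = 0 :=
  SkewPolynomial.monomial_zero_right n

theorem one_eq_monomial : (1 : Ore σ) = monomial 0 1 := rfl

theorem induction_monomial {P : Ore σ → Prop} (f : Ore σ)
    (monomial : ∀ n a, P (monomial n a)) (add : ∀ f g, P f → P g → P (f + g)) : P f :=
  SkewPolynomial.induction f (monomial_zero (σ := σ) 0 ▸ monomial 0 0)
    fun n a q _ _ hq => add _ q (monomial n a) hq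

theorem coeff_mul (f g : Ore σ) (n : ℕ) :
    coeff (f * g) n = ∑ x ∈ antidiagonal n, coeff f x.1 * σ^[x.1] (coeff g x.2) := by
  induction f using induction_monomial with
  | add f₁ f₂ h₁ h₂ => simp only [add_mul, coeff_add, h₁, h₂, sum_add_distrib]
  | monomial i a =>
    induction g using induction_monomial with
    | add g₁ g₂ h₁ h₂ =>
      simp only [mul_add, coeff_add, h₁, h₂, iterate_map_add, sum_add_distrib]
    | monomial j b =>
      rw [monomial_mul_monomial, coeff_monomial]
      simp only [coeff_monomial, ite_mul, zero_mul]
      split_ifs with h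
      · rw [sum_eq_single (i, j)]
        · simp
        · rintro ⟨k, l⟩ hkl hne
          simp only [HasAntidiagonal.mem_antidiagonal] at hkl
          split_ifs with h₁ h₂
          · exact absurd (Prod.ext h₁.symm h₂.symm) hne
          · simp [iterate_map_zero]
          · rfl
        · exact fun hn => absurd (HasAntidiagonal.mem_antidiagonal.2 h) hn
      · refine (sum_eq_zero ?_).symm
        rintro ⟨k, l⟩ hkl
        simp only [HasAntidiagonal.mem_antidiagonal] at hkl
        split_ifs with h₁ h₂
        · exact absurd (h₁ ▸ h₂ ▸ hkl) h
        · simp [iterate_map_zero]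
        · rfl

theorem monomial_mul_coeff (i n : ℕ) (a : A) (f : Ore σ) :
    coeff (monomial i a * f) n = if i ≤ n then a * σ^[i] (coeff f (n - i)) else 0 := by
  rw [coeff_mul]
  simp only [coeff_monomial, ite_mul, zero_mul]
  split_ifs with h
  · rw [sum_eq_single (i, n - i)]
    · simp
    · rintro ⟨k, l⟩ hkl hne
      simp only [HasAntidiagonal.mem_antidiagonal] at hkl
      refine if_neg fun hik => hne ?_
      dsimp only at hik
      rw [Prod.mk.injEq]
      omega
    · exact fun hn => absurd (HasAntidiagonal.mem_antidiagonal.2 (by dsimp only; omega)) hn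
  · refine sum_eq_zero ?_
    rintro ⟨k, l⟩ hkl
    simp only [HasAntidiagonal.mem_antidiagonal] at hkl
    exact if_neg (by dsimp only; omega)

theorem coeff_C_mul (a : A) (f : Ore σ) (n : ℕ) : coeff (C a * f) n = a * coeff f n := by
  simp [C, monomial_mul_coeff]

theorem coeff_X_mul_zero (f : Ore σ) : coeff (X * f) 0 = 0 := by
  simp [X, monomial_mul_coeff]

theorem coeff_X_mul_succ (f : Ore σ) (n : ℕ) : coeff (X * f) (n + 1) = σ (coeff f n) := by
  simp [X, monomial_mul_coeff]

theorem X_pow_eq_monomial (n : ℕ) : (X ^ n : Ore σ) = monomial n 1 := by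
  induction n with
  | zero => exact pow_zero _
  | succ n ih => rw [pow_succ, ih, X, monomial_mul_monomial, iterate_map_one, one_mul]

end Coefficients

/-! ### The extension of `σ` and commutation with `t` -/

section Extend

variable {A : Type*} [Ring A] {σ : A →+* A}

theorem coeff_extend (f : Ore σ) (n : ℕ) : coeff (extend f) n = σ (coeff f n) := by
  refine (congrArg (coeff · n) (SkewPolynomial.sum_def (R := A) f
    fun i a => (monomial i (σ a) : Ore σ))).trans ?_
  refine (coeff_sum _ _ n).trans ?_
  simp only [coeff_monomial, sum_ite_eq']
  split_ifs with h
  · rfl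
  · have h := SkewPolynomial.notMem_support_iff.1 h
    exact ((congrArg σ h).trans (map_zero σ)).symm

theorem coeff_extend_iterate (k : ℕ) (f : Ore σ) (n : ℕ) :
    coeff (extend^[k] f) n = σ^[k] (coeff f n) := by
  induction k with
  | zero => rfl
  | succ k ih => rw [Function.iterate_succ_apply', Function.iterate_succ_apply', coeff_extend, ih]

theorem extend_mul (f g : Ore σ) : extend (f * g) = extend f * extend g := by
  refine ext_coeff fun n => ?_
  simp only [coeff_extend, coeff_mul, map_sum, map_mul, ← Function.iterate_succ_apply,
    Function.iterate_succ_apply']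

theorem extend_iterate_mul (k : ℕ) (f g : Ore σ) :
    extend^[k] (f * g) = extend^[k] f * extend^[k] g := by
  induction k with
  | zero => rfl
  | succ k ih => simp only [Function.iterate_succ_apply', ih, extend_mul]

theorem X_mul_eq_extend_mul_X (f : Ore σ) : X * f = extend f * X := by
  induction f using induction_monomial with
  | add f g hf hg =>
    have : extend (f + g) = extend f + extend g :=
      ext_coeff fun n => by simp only [coeff_extend, coeff_add, map_add]
    rw [mul_add, this, add_mul, hf, hg]
  | monomial n a =>
    have : extend (monomial n a : Ore σ) = monomial n (σ a) :=
      ext_coeff fun m => by simp only [coeff_extend, coeff_monomial, apply_ite σ, map_zero]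
    rw [this, X, monomial_mul_monomial, monomial_mul_monomial, add_comm]
    simp

theorem X_pow_mul_eq (k : ℕ) (f : Ore σ) : X ^ k * f = extend^[k] f * X ^ k := by
  induction k with
  | zero => simp
  | succ k ih =>
    rw [pow_succ', mul_assoc, ih, ← mul_assoc, X_mul_eq_extend_mul_X, mul_assoc,
      Function.iterate_succ_apply']

end Extend

/-! ### Degree arguments -/

section Degree

variable {A : Type*} [Ring A] {σ : A →+* A}

theorem coeff_mul_add_of_vanish {f g : Ore σ} {d e : ℕ} (hf : ∀ i, d < i → coeff f i = 0)
    (hg : ∀ i, e < i → coeff g i = 0) :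
    coeff (f * g) (d + e) = coeff f d * σ^[d] (coeff g e) := by
  rw [coeff_mul, sum_eq_single (d, e)]
  · rintro ⟨k, l⟩ hkl hne
    simp only [HasAntidiagonal.mem_antidiagonal] at hkl
    rcases lt_trichotomy d k with h | h | h
    · simp [hf k h]
    · exact absurd (Prod.ext h.symm (by dsimp only; omega)) hne
    · simp [hg l (by omega), iterate_map_zero]
  · exact fun hn => (hn (HasAntidiagonal.mem_antidiagonal.2 rfl)).elim

theorem exists_leadingCoeff {f : Ore σ} (hf : f ≠ 0) :
    ∃ d, coeff f d ≠ 0 ∧ ∀ i, d < i → coeff f i = 0 := by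
  have hs : (SkewPolynomial.support (R := A) f).Nonempty := by
    rw [nonempty_iff_ne_empty]
    exact fun h => hf (SkewPolynomial.support_eq_empty.1 h)
  refine ⟨_, SkewPolynomial.mem_support_iff.1 (max'_mem _ hs), fun i hi => ?_⟩
  by_contra h
  exact absurd (le_max' _ i (SkewPolynomial.mem_support_iff.2 h)) (not_le.2 hi)

theorem IsMonicOfDegree.ne_zero [Nontrivial A] {f : Ore σ} {d : ℕ} (hf : IsMonicOfDegree f d) :
    f ≠ 0 := by
  rintro rfl
  exact zero_ne_one hf.1

/-- Leading coefficients `a`, `b` give the product the coefficient `a σ^d(b)` in top degree, nonzero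
because `σ` is injective. -/
theorem noZeroDivisors [NoZeroDivisors A] (hσ : Function.Injective σ) :
    NoZeroDivisors (Ore σ) where
  eq_zero_or_eq_zero_of_mul_eq_zero {f g} h := by
    by_contra! hfg
    obtain ⟨d, hd, hd'⟩ := exists_leadingCoeff hfg.1
    obtain ⟨e, he, he'⟩ := exists_leadingCoeff hfg.2
    have := coeff_mul_add_of_vanish hd' he'
    rw [h, coeff_zero] at this
    rcases mul_eq_zero.1 this.symm with h | h
    · exact hd h
    · exact he (hσ.iterate d (h.trans (iterate_map_zero σ d).symm))

theorem eq_zero_of_mul_monic_of_vanish {u f : Ore σ} {N : ℕ} (hf : IsMonicOfDegree f N)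
    (h : ∀ i, N ≤ i → coeff (u * f) i = 0) : u = 0 := by
  by_contra hu
  obtain ⟨d, hd, hd'⟩ := exists_leadingCoeff hu
  have := coeff_mul_add_of_vanish hd' hf.2
  rw [hf.1, iterate_map_one, mul_one, h _ (Nat.le_add_left _ _)] at this
  exact hd this.symm

theorem coeff_eq_zero_of_monic_mul_eq {f g h : Ore σ} {N r : ℕ} (hσ : Function.Injective σ)
    (hf : IsMonicOfDegree f N) (hg : IsMonicOfDegree g r) (hr : 1 ≤ r) (hfg : f = g * h) :
    ∀ i, N ≤ i → coeff h i = 0 := by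
  intro i hi
  by_cases hh : h = 0
  · rw [hh, coeff_zero]
  obtain ⟨e, he, he'⟩ := exists_leadingCoeff hh
  by_contra hne
  have hie : i ≤ e := not_lt.1 fun hlt => hne (he' i hlt)
  -- As `e ≥ i ≥ N` and `r ≥ 1`, the top degree `r + e` of `g h` exceeds `N`, where `f` vanishes.
  have := coeff_mul_add_of_vanish hg.2 he'
  rw [← hfg, hf.2 _ (by omega), hg.1, one_mul] at this
  exact he (hσ.iterate r (this.symm.trans (iterate_map_zero σ r).symm))

end Degree

/-! ### Coordinates modulo `R f` and control matrices -/

section Control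

variable {A : Type*} [Ring A] {σ : A →+* A} {N : ℕ}

theorem coeff_vecPoly (v : Fin N → A) (k : ℕ) :
    coeff (vecPoly σ v) k = if h : k < N then v ⟨k, h⟩ else 0 := by
  rw [vecPoly, coeff_sum]
  simp only [coeff_monomial]
  split_ifs with h
  · rw [sum_eq_single ⟨k, h⟩]
    · simp
    · exact fun i _ hi => if_neg fun hik => hi (Fin.ext hik)
    · simp
  · exact sum_eq_zero fun i _ => if_neg (by omega)

theorem vecPoly_coeffVec {f : Ore σ} (hf : ∀ i, N ≤ i → coeff f i = 0) :
    vecPoly σ (coeffVec N f) = f := by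
  refine ext_coeff fun k => ?_
  rw [coeff_vecPoly]
  split_ifs with h
  · rfl
  · exact (hf k (not_lt.1 h)).symm

theorem vecPoly_vecMul {m : ℕ} (c : Fin m → A) (H : Matrix (Fin m) (Fin N) A) :
    vecPoly σ (Matrix.vecMul c H) = ∑ i, C (c i) * vecPoly σ (H i) := by
  refine ext_coeff fun k => ?_
  simp only [coeff_sum, coeff_C_mul, coeff_vecPoly]
  split_ifs with h
  · rfl
  · simp

theorem vecPoly_eq_sum_C_mul_X_pow (c : Fin N → A) :
    vecPoly σ c = ∑ i, C (c i) * X ^ (i : ℕ) := by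
  refine sum_congr rfl fun i _ => ?_
  rw [X_pow_eq_monomial, C, monomial_mul_monomial, zero_add, Function.iterate_zero, id, mul_one]

theorem pseudoLinear_apply_zero {f : Ore σ} (v : Fin (N + 1) → A) :
    pseudoLinear (N + 1) f v 0 = -(σ (v (Fin.last N)) * coeff f 0) := by
  simp only [pseudoLinear, Matrix.vecMul, dotProduct, companion, Matrix.of_apply]
  rw [sum_eq_single (Fin.last N)]
  · simp
  · intro i _ hi
    have : (i : ℕ) ≠ N := fun h => hi (Fin.ext h)
    simp [this]
  · simp

theorem pseudoLinear_apply_succ {f : Ore σ} (v : Fin (N + 1) → A) (j : Fin N) :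
    pseudoLinear (N + 1) f v j.succ =
      σ (v j.castSucc) - σ (v (Fin.last N)) * coeff f (j + 1) := by
  simp only [pseudoLinear, Matrix.vecMul, dotProduct, companion, Matrix.of_apply]
  rw [Fin.sum_univ_castSucc, sum_eq_single j]
  · have : (j : ℕ) ≠ N := j.2.ne
    simp [this, sub_eq_add_neg]
  · intro i _ hi
    have h₁ : (i : ℕ) ≠ N := i.2.ne
    have h₂ : (j : ℕ) ≠ i := fun h => hi (Fin.ext h.symm)
    simp [h₁, h₂]
  · simp

/-- One step of division by `f`: the only overflow of `t v` is the top term with coefficient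
`σ(v_N)`. Thus `T_f` is multiplication by `t` on `R / R f`. -/
theorem X_mul_vecPoly {f : Ore σ} (hf : IsMonicOfDegree f (N + 1)) (v : Fin (N + 1) → A) :
    X * vecPoly σ v =
      vecPoly σ (pseudoLinear (N + 1) f v) + C (σ (v (Fin.last N))) * f := by
  refine ext_coeff fun k => ?_
  rw [coeff_add, coeff_C_mul, coeff_vecPoly]
  rcases k with _ | k
  · rw [coeff_X_mul_zero, dif_pos N.succ_pos]
    have := pseudoLinear_apply_zero (f := f) v
    exact (eq_neg_iff_add_eq_zero.1 this).symm
  · rw [coeff_X_mul_succ, coeff_vecPoly]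
    rcases lt_trichotomy k N with h | h | h
    · rw [dif_pos (by omega), dif_pos (by omega)]
      have := pseudoLinear_apply_succ (f := f) v ⟨k, h⟩
      exact (sub_eq_iff_eq_add.1 this.symm)
    · subst h
      rw [dif_pos (by omega), dif_neg (by omega), hf.1, mul_one, zero_add]
      rfl
    · rw [dif_neg (by omega), dif_neg (by omega), hf.2 _ (by omega)]
      simp

theorem X_pow_mul_vecPoly_sub_mem {f : Ore σ} (hf : IsMonicOfDegree f (N + 1))
    (v : Fin (N + 1) → A) (k : ℕ) :
    X ^ k * vecPoly σ v - vecPoly σ ((pseudoLinear (N + 1) f)^[k] v) ∈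
      (Ideal.span {f} : Ideal (Ore σ)) := by
  induction k with
  | zero => simp
  | succ k ih =>
    have h := Ideal.add_mem _ (Ideal.mul_mem_left _ X ih)
      (Ideal.mul_mem_left _ (C (σ ((pseudoLinear (N + 1) f)^[k] v (Fin.last N))))
        (Ideal.mem_span_singleton_self f))
    rw [mul_sub, X_mul_vecPoly hf, ← mul_assoc, ← pow_succ'] at h
    rw [Function.iterate_succ_apply']
    convert h using 1
    abel

theorem vecPoly_mul_sub_mem {f : Ore σ} (hf : IsMonicOfDegree f (N + 1))
    (c v : Fin (N + 1) → A) :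
    vecPoly σ c * vecPoly σ v - vecPoly σ (Matrix.vecMul c (orbitMatrix (N + 1) f v)) ∈
      (Ideal.span {f} : Ideal (Ore σ)) := by
  rw [vecPoly_vecMul, vecPoly_eq_sum_C_mul_X_pow c, sum_mul, ← sum_sub_distrib]
  refine Ideal.sum_mem _ fun i _ => ?_
  rw [mul_assoc, ← mul_sub]
  exact Ideal.mul_mem_left _ _ (X_pow_mul_vecPoly_sub_mem hf v i)

/-- A nonzero left multiple of a monic `f` has degree at least `N`, so coordinates modulo `R f` are
faithful. -/
theorem vecPoly_mem_span_iff {f : Ore σ} (hf : IsMonicOfDegree f N) (w : Fin N → A) :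
    vecPoly σ w ∈ (Ideal.span {f} : Ideal (Ore σ)) ↔ w = 0 := by
  have hw : ∀ i, N ≤ i → coeff (vecPoly σ w) i = 0 := fun i hi => by
    rw [coeff_vecPoly, dif_neg (not_lt.2 hi)]
  constructor
  · intro h
    obtain ⟨u, hu⟩ := Ideal.mem_span_singleton'.1 h
    have hu' := eq_zero_of_mul_monic_of_vanish hf (hu ▸ hw)
    ext i
    have := coeff_vecPoly (σ := σ) w i
    rw [← hu, hu', zero_mul, coeff_zero, dif_pos i.2] at this
    exact this.symm
  · rintro rfl
    simp [vecPoly, monomial_zero]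

theorem mem_code_iff {f g : Ore σ} (hfg : f ∈ (Ideal.span {g} : Ideal (Ore σ)))
    (c : Fin N → A) : c ∈ code N f g ↔ vecPoly σ c ∈ (Ideal.span {g} : Ideal (Ore σ)) := by
  have hle : (Ideal.span {f} : Ideal (Ore σ)) ≤ Ideal.span {g} := by
    rwa [Ideal.span_singleton_le_iff_mem]
  rw [code, Set.mem_ofPred_eq, ← Submodule.mem_comap, Submodule.comap_map_mkQ]
  rw [sup_eq_right.2 hle]

/-- If `f = h g = g h'` with `h'` of degree less than that of `f`, then the orbit of `h'` under
`T_f` gives a control matrix of the code of `R g / R f`. -/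
theorem isControlMatrix_orbitMatrix [NoZeroDivisors A] [Nontrivial A]
    (hσ : Function.Injective σ) {f g h h' : Ore σ} (hN : 1 ≤ N) (hf : IsMonicOfDegree f N)
    (hfg : f = h * g) (hfg' : f = g * h') (hh' : ∀ i, N ≤ i → coeff h' i = 0) :
    IsControlMatrix (orbitMatrix N f (coeffVec N h')) (code N f g) := by
  have := noZeroDivisors hσ
  obtain ⟨N, rfl⟩ := Nat.exists_eq_add_of_le' hN
  have hh'0 : h' ≠ 0 := by
    rintro rfl
    exact hf.ne_zero (by rw [hfg', mul_zero])
  ext c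
  have key : vecPoly σ c * h' ∈ (Ideal.span {f} : Ideal (Ore σ)) ↔
      vecPoly σ (Matrix.vecMul c (orbitMatrix (N + 1) f (coeffVec (N + 1) h'))) ∈
        (Ideal.span {f} : Ideal (Ore σ)) := by
    have := vecPoly_mul_sub_mem hf c (coeffVec (N + 1) h')
    rw [vecPoly_coeffVec hh'] at this
    exact ⟨fun hm => (Submodule.sub_mem_iff_right _ hm).1 this,
      fun hm => (Submodule.sub_mem_iff_left _ hm).1 this⟩
  rw [mem_code_iff (Ideal.mem_span_singleton'.2 ⟨h, hfg.symm⟩), Set.mem_ofPred_eq,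
    ← vecPoly_mem_span_iff hf, ← key, Ideal.mem_span_singleton', Ideal.mem_span_singleton']
  -- The same `u` serves both sides: `u g = c` iff `u g h' = c h'`, by cancelling `h'`.
  refine exists_congr fun u => ?_
  rw [hfg', ← mul_assoc, mul_left_inj' hh'0]

end Control

/-! ### Constant coefficients and right division by `t` -/

theorem pos_of_card_eq_pow {F : Type*} [Nontrivial F] {p n : ℕ} (hF : Nat.card F = p ^ n) :
    1 ≤ n := by
  rcases n with _ | n
  · have := (Nat.card_eq_one_iff_unique.1 (hF.trans (pow_zero p))).1
    exact absurd this (not_subsingleton F)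
  · exact n.succ_pos

/-- All norms `Nᵢ(0)` with `i ≥ 1` vanish. -/
theorem eval_zero_eq_coeff {A : Type*} [Ring A] {σ : A →+* A} (f : Ore σ) :
    eval f 0 = coeff f 0 := by
  refine (SkewPolynomial.sum_def (R := A) f _).trans ?_
  have h : ∀ i, i ≠ 0 → normPow σ 0 i = 0 := fun i hi => by
    obtain ⟨i, rfl⟩ := Nat.exists_eq_succ_of_ne_zero hi
    exact mul_zero _
  rw [sum_eq_single 0]
  · exact mul_one _
  · exact fun i _ hi => by rw [h i hi, mul_zero]
  · exact fun h0 => by rw [SkewPolynomial.notMem_support_iff.1 h0, zero_mul]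

theorem exists_eq_mul_X_add_C {A : Type*} [Ring A] {σ : A →+* A} (f : Ore σ) :
    ∃ k : Ore σ, f = k * X + C (coeff f 0) := by
  induction f using induction_monomial with
  | add f g hf hg =>
    obtain ⟨k, hk⟩ := hf
    obtain ⟨l, hl⟩ := hg
    refine ⟨k + l, ?_⟩
    have hC : C (coeff (f + g) 0) = (C (coeff f 0) + C (coeff g 0) : Ore σ) := by
      rw [coeff_add]
      exact SkewPolynomial.monomial_add 0 _ _
    rw [hC, add_mul, add_add_add_comm, ← hk, ← hl]
  | monomial n a =>
    rcases n with _ | n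
    · exact ⟨0, by rw [zero_mul, zero_add, coeff_monomial, if_pos rfl, C]⟩
    · refine ⟨monomial n a, ?_⟩
      rw [X, monomial_mul_monomial, iterate_map_one, mul_one, coeff_monomial,
        if_neg n.succ_ne_zero, C, monomial_zero, add_zero]

/-! ### The polynomials `G` and `G₀` over a finite field -/

section Finite

variable (F : Type*) [Field F] (p n : ℕ) [Fact p.Prime] [CharP F p]

theorem frobenius_iterate_card (hF : Nat.card F = p ^ n) (a : F) : (frobenius F p)^[n] a = a := by
  have : Finite F :=
    Nat.finite_of_card_ne_zero (hF ▸ pow_ne_zero n (Fact.out : p.Prime).ne_zero)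
  have := Fintype.ofFinite F
  rw [iterate_frobenius, ← hF, Nat.card_eq_fintype_card, FiniteField.pow_card]

variable {F p n}

theorem extend_iterate_card (hF : Nat.card F = p ^ n) (f : Ore (frobenius F p)) :
    extend^[n] f = f :=
  ext_coeff fun k => by rw [coeff_extend_iterate, frobenius_iterate_card F p n hF]

theorem X_pow_mul_comm (hF : Nat.card F = p ^ n) (f : Ore (frobenius F p)) (m : ℕ) :
    X ^ (m * n) * f = f * X ^ (m * n) := by
  rw [X_pow_mul_eq, mul_comm m n, Function.iterate_mul]
  congr 1
  exact Function.iterate_fixed (extend_iterate_card hF f) m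

theorem polyG₀_mul_comm (hF : Nat.card F = p ^ n) (f : Ore (frobenius F p)) :
    polyG₀ F p n * f = f * polyG₀ F p n := by
  rw [polyG₀, sub_mul, mul_sub, X_pow_mul_comm hF, one_mul, mul_one]

theorem polyG_eq_X_mul : polyG F p n = X * polyG₀ F p n := by
  rw [polyG, polyG₀, mul_sub, mul_one, ← pow_succ']

theorem polyG_eq_mul_X : polyG F p n = polyG₀ F p n * X := by
  rw [polyG, polyG₀, sub_mul, one_mul, ← pow_succ]

theorem polyG_mul (hF : Nat.card F = p ^ n) (f : Ore (frobenius F p)) :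
    polyG F p n * f = extend f * polyG F p n := by
  rw [polyG_eq_X_mul, mul_assoc, polyG₀_mul_comm hF, ← mul_assoc, X_mul_eq_extend_mul_X, mul_assoc]

theorem isMonicOfDegree_polyG (hn : 1 ≤ n) :
    IsMonicOfDegree (polyG F p n) ((p - 1) * n + 1) := by
  have hp := (Fact.out : p.Prime).two_le
  have : 1 ≤ (p - 1) * n := Nat.mul_pos (by omega) hn
  refine ⟨?_, fun i hi => ?_⟩ <;>
  rw [polyG, X_pow_eq_monomial, X, coeff_sub, coeff_monomial, coeff_monomial]
  · rw [if_pos rfl, if_neg (by omega), sub_zero]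
  · rw [if_neg (by omega), if_neg (by omega), sub_zero]

theorem isMonicOfDegree_polyG₀ (hn : 1 ≤ n) :
    IsMonicOfDegree (polyG₀ F p n) ((p - 1) * n) := by
  have hp := (Fact.out : p.Prime).two_le
  have : 1 ≤ (p - 1) * n := Nat.mul_pos (by omega) hn
  refine ⟨?_, fun i hi => ?_⟩ <;>
  rw [polyG₀, X_pow_eq_monomial, one_eq_monomial, coeff_sub, coeff_monomial, coeff_monomial]
  · rw [if_pos rfl, if_neg (by omega), sub_zero]
  · rw [if_neg (by omega), if_neg (by omega), sub_zero]

variable (F p) in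
theorem X_ne_zero : (X : Ore (frobenius F p)) ≠ 0 :=
  IsMonicOfDegree.ne_zero (d := 1) ⟨by rw [X, coeff_monomial, if_pos rfl], fun i hi => by
    rw [X, coeff_monomial, if_neg hi.ne]⟩

/-- After right multiplication by `t` this says that `t` commutes with `G`: `t G = t G₀ t = G t`. -/
theorem extend_polyG : extend (polyG F p n) = polyG F p n := by
  have := noZeroDivisors (frobenius_inj F p)
  refine mul_right_cancel₀ (X_ne_zero F p) ?_
  rw [← X_mul_eq_extend_mul_X]
  nth_rw 1 [polyG_eq_mul_X]
  rw [← mul_assoc, ← polyG_eq_X_mul]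

/-- If `θˡ(g) = g` with `l ≥ 1`, then `G = h g` implies `G = g θˡ⁻¹(h)`. -/
theorem polyG_eq_mul_extend_iterate (hF : Nat.card F = p ^ n) {g h : Ore (frobenius F p)}
    (hg : g ≠ 0) (hG : polyG F p n = h * g) {l : ℕ} (hl : 1 ≤ l) (hlg : extend^[l] g = g) :
    polyG F p n = g * extend^[l - 1] h := by
  have := noZeroDivisors (frobenius_inj F p)
  obtain ⟨l, rfl⟩ := Nat.exists_eq_add_of_le' hl
  rw [Nat.add_sub_cancel]
  rw [Function.iterate_succ_apply'] at hlg
  have hg' : extend^[l] g ≠ 0 := fun h0 => hg (by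
    rw [← hlg, h0]
    exact ext_coeff fun n => by rw [coeff_extend, coeff_zero, map_zero])
  -- With `l` now denoting the old `l - 1`: `G θ^l(g) = θ^(l+1)(g) G = g G`, and `G = θ^l(G) =
  -- θ^l(h) θ^l(g)`.
  refine mul_right_cancel₀ hg' ?_
  rw [polyG_mul hF, hlg, mul_assoc, ← extend_iterate_mul, ← hG,
    Function.iterate_fixed extend_polyG]

/-- If `G = h g` and `g(0) ≠ 0`, then `g` divides `G₀` on both sides with the same quotient. -/
theorem exists_polyG₀_eq_mul (hF : Nat.card F = p ^ n) {g h : Ore (frobenius F p)}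
    (hG : polyG F p n = h * g) (hg : coeff g 0 ≠ 0) :
    ∃ h', polyG₀ F p n = h' * g ∧ polyG₀ F p n = g * h' := by
  have := noZeroDivisors (frobenius_inj F p)
  have hn := pos_of_card_eq_pow hF
  have hh : coeff h 0 = 0 := by
    have h0 : coeff (h * g) 0 = 0 := by rw [← hG, polyG_eq_X_mul, coeff_X_mul_zero]
    rw [coeff_mul] at h0
    exact (mul_eq_zero.1 (by simpa using h0)).resolve_right hg
  obtain ⟨k, hk⟩ := exists_eq_mul_X_add_C h
  rw [hh, C, monomial_zero, add_zero] at hk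
  -- The exponent `n - 1` inverts `θ`: `t θ^(n-1)(k) = θ^n(k) t = k t`. The factor `t` is now on the
  -- left and cancels against `G = t G₀`.
  have hk' : h = X * extend^[n - 1] k := by
    rw [X_mul_eq_extend_mul_X, ← Function.iterate_succ_apply' extend, Nat.succ_eq_add_one,
      Nat.sub_add_cancel hn, extend_iterate_card hF, hk]
  have h₁ : polyG₀ F p n = extend^[n - 1] k * g := by
    refine mul_left_cancel₀ (X_ne_zero F p) ?_
    rw [← polyG_eq_X_mul, hG, hk', mul_assoc]
  refine ⟨extend^[n - 1] k, h₁, ?_⟩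
  have hne : extend^[n - 1] k ≠ 0 := fun h0 =>
    (isMonicOfDegree_polyG₀ (F := F) (p := p) hn).ne_zero (by rw [h₁, h0, zero_mul])
  -- With `h' = θ^(n-1)(k)`, centrality gives `h' G₀ = G₀ h' = h' g h'`.
  refine mul_left_cancel₀ hne ?_
  rw [← polyG₀_mul_comm hF, ← mul_assoc, ← h₁]

end Finite

end OreCode

theorem mainTheorem6 (F : Type*) [Field F] (p n : ℕ) [Fact p.Prime] [CharP F p]
    (hF : Nat.card F = p ^ n) (r : ℕ) (g h : OreCode.Ore (frobenius F p))
    (hg : OreCode.IsWPolynomial g r) (hG : OreCode.polyG F p n = h * g) :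
    (∃ l : ℕ, 1 ≤ l ∧ l ≤ n ∧ OreCode.extend^[l] g = g) ∧
    (∀ l : ℕ, 1 ≤ l → l ≤ n → OreCode.extend^[l] g = g →
      OreCode.polyG F p n = g * OreCode.extend^[l - 1] h ∧
      (1 ≤ r →
        OreCode.IsControlMatrix
          (OreCode.orbitMatrix ((p - 1) * n + 1) (OreCode.polyG F p n)
            fun j => (frobenius F p)^[l - 1] (OreCode.coeffVec ((p - 1) * n + 1) h j))
          (OreCode.code ((p - 1) * n + 1) (OreCode.polyG F p n) g))) ∧
    (OreCode.eval g 0 ≠ 0 →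
      ∃ h' : OreCode.Ore (frobenius F p),
        OreCode.polyG₀ F p n = h' * g ∧ OreCode.polyG₀ F p n = g * h' ∧
        (1 ≤ r →
          OreCode.IsControlMatrix
            (OreCode.orbitMatrix ((p - 1) * n) (OreCode.polyG₀ F p n)
              (OreCode.coeffVec ((p - 1) * n) h'))
            (OreCode.code ((p - 1) * n) (OreCode.polyG₀ F p n) g))) := by
  have hn := OreCode.pos_of_card_eq_pow hF
  have hinj := frobenius_inj F p
  have hp := (Fact.out : p.Prime).two_le
  refine ⟨⟨n, hn, le_rfl, OreCode.extend_iterate_card hF g⟩, fun l hl _ hlg => ?_, fun hg0 => ?_⟩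
  · have hG' := OreCode.polyG_eq_mul_extend_iterate hF hg.1.ne_zero hG hl hlg
    refine ⟨hG', fun hr => ?_⟩
    have hmonic := OreCode.isMonicOfDegree_polyG (F := F) (p := p) hn
    -- The first row is the coordinate vector of the left cofactor `θ^(l-1)(h)` turned right factor
    -- in `G = g θ^(l-1)(h)`.
    have hvec : (fun j => (frobenius F p)^[l - 1] (OreCode.coeffVec ((p - 1) * n + 1) h j)) =
        OreCode.coeffVec ((p - 1) * n + 1) (OreCode.extend^[l - 1] h) :=
      funext fun j => (OreCode.coeff_extend_iterate _ _ _).symm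
    rw [hvec]
    exact OreCode.isControlMatrix_orbitMatrix hinj (Nat.le_add_left _ _) hmonic hG hG'
      (OreCode.coeff_eq_zero_of_monic_mul_eq hinj hmonic hg.1 hr hG')
  · obtain ⟨h', h₁, h₂⟩ :=
      OreCode.exists_polyG₀_eq_mul hF hG (OreCode.eval_zero_eq_coeff g ▸ hg0)
    have hmonic := OreCode.isMonicOfDegree_polyG₀ (F := F) (p := p) hn
    exact ⟨h', h₁, h₂, fun hr => OreCode.isControlMatrix_orbitMatrix hinj
      (Nat.mul_pos (by omega) hn) hmonic h₁ h₂
      (OreCode.coeff_eq_zero_of_monic_mul_eq hinj hmonic hg.1 hr h₂)⟩
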